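/- For $n\ge 0$ let $B_n$ be the lattice of subsets of $[n]=\{1,\dots,n\}$ ordered by inclusion. The Lubell mass of $\mathcal F\subseteq B_n$ is $\lambda_n(\mathcal F)=\sum_{F\in\mathcal F}\binom{n}{|F|}^{-1}$. A partial $2$-coloring of $B_n$ assigns one of the colors $1,2$ to each member of some subset of $B_n$; it admits a strong rainbow copy of the two-element antichain $A_2$ if there are two sets, incomparable under inclusion, that are colored with different colors. Let $F'(n,2)$ be the smallest integer $m$ such that every partial $2$-coloring of $B_n$ both of whose color classes have size at least $m$ admits a strong rainbow copy of $A_2$. Let $G'(n,2)$ be the infimum of all reals $\gamma$ such that every partial $2$-coloring of $B_n$ both of whose color classes have Lubell mass at least $\gamma$ admits a strong rainbow copy of $A_2$. Families $\mathcal F_1,\mathcal F_2\subseteq B_n$ are mutually comparable if for all $F_1\in\mathcal F_1$, $F_2\in\mathcal F_2$ we have $F_1\subseteq F_2$ or $F_2\subseteq F_1$. If $\mathcal F_1,\mathcal F_2$ are disjoint, a core chain for them is a chain $\emptyset=S_0\subseteq S_1\subseteq\dots\subseteq S_m=[n]$ such that every member of $\mathcal F_1\cup\mathcal F_2$ lies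 in $\{F: S_j\subseteq F\subseteq S_{j+1}\}$ for some $0\le j<m$, and for no $j$ does the truncated subcube $\{F: S_j\subsetneq F\subsetneq S_{j+1}\}$ contain members of both families. **Corollary 4.5.** (i) $F'(n,2)=2^{\lfloor n/2\rfloor}+2$ if $n\ge 5$ is odd, and $F'(n,2)=2^{\lfloor n/2\rfloor}$ if $n\ne 2$ is even. (ii) If $\mathcal F_1,\mathcal F_2\subseteq B_n$ are disjoint mutually comparable families with a core chain that contains neither a set of size $\lfloor n/2\rfloor$ nor a set of size $\lceil n/2\rceil$, then $$\min\{|\mathcal F_1|,|\mathcal F_2|\}\le 2^{\lfloor n/2\rfloor-1}+4.$$ (iii) $\lim_{n\to\infty}G'(n,2)=\sqrt2+1$. -/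

import Mathlib

open Filter Topology

namespace RainbowBoolean

/-- The Boolean lattice `B_n`: the subsets of an `n`-element set, ordered by inclusion. -/
abbrev BoolLattice (n : ℕ) : Type := Finset (Fin n)

/-- The antichain poset `A_k`: `k` pairwise incomparable elements. -/
structure AntichainPoset (k : ℕ) where
  /-- the index of the element -/
  idx : Fin k

instance (k : ℕ) : PartialOrder (AntichainPoset k) where
  le a b := a = b
  le_refl _ := rfl
  le_trans _ _ _ h₁ h₂ := Eq.trans h₁ h₂
  le_antisymm _ _ h _ := h

/-- `X ⊆ Q` is a strong (induced) copy of `P`: there is a bijection `α : P → X` such that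
`p ≤ p'` holds if and only if `α p ≤ α p'`. -/
def IsStrongCopy (P : Type) [PartialOrder P] {Q : Type} [PartialOrder Q] (X : Set Q) : Prop :=
  ∃ α : P ≃ X, ∀ p p' : P, p ≤ p' ↔ (α p : Q) ≤ (α p' : Q)

/-- A partial `k`-coloring of `B_n`; the value `none` means that the set is not colored. -/
abbrev PartialColoring (n k : ℕ) : Type := BoolLattice n → Option (Fin k)

/-- The color class of the color `i`. -/
def PartialColoring.colorClass {n k : ℕ} (φ : PartialColoring n k) (i : Fin k) :
    Finset (BoolLattice n) :=
  Finset.univ.filter fun F => φ F = some i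

/-- `X` is rainbow: all its elements are colored, with pairwise distinct colors. -/
def PartialColoring.IsRainbow {n k : ℕ} (φ : PartialColoring n k) (X : Set (BoolLattice n)) :
    Prop :=
  (∀ F ∈ X, φ F ≠ none) ∧ ∀ F ∈ X, ∀ G ∈ X, F ≠ G → φ F ≠ φ G

/-- The partial `k`-coloring `φ` admits a strong rainbow copy of `A_k`. -/
def PartialColoring.AdmitsRainbowAntichain {n k : ℕ} (φ : PartialColoring n k) : Prop :=
  ∃ X : Set (BoolLattice n), IsStrongCopy (AntichainPoset k) X ∧ φ.IsRainbow X

/-- The Lubell mass `λ_n(𝓕) = ∑_{F ∈ 𝓕} 1 / (n choose |F|)`. -/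
noncomputable def lubellMass {n : ℕ} (𝓕 : Finset (BoolLattice n)) : ℝ :=
  ∑ F ∈ 𝓕, 1 / (n.choose F.card : ℝ)

/-- `F'(n,k)`: the smallest integer `m` such that every partial `k`-coloring of `B_n` all of whose
color classes have size at least `m` admits a strong rainbow copy of `A_k`. -/
noncomputable def FPrime (n k : ℕ) : ℕ :=
  sInf {m : ℕ | ∀ φ : PartialColoring n k,
    (∀ i : Fin k, m ≤ (φ.colorClass i).card) → φ.AdmitsRainbowAntichain}

/-- `G'(n,k)`: the infimum of all reals `γ` such that every partial `k`-coloring of `B_n` all of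
whose color classes have Lubell mass at least `γ` admits a strong rainbow copy of `A_k`. -/
noncomputable def GPrime (n k : ℕ) : ℝ :=
  sInf {γ : ℝ | ∀ φ : PartialColoring n k,
    (∀ i : Fin k, γ ≤ lubellMass (φ.colorClass i)) → φ.AdmitsRainbowAntichain}

/-- The families `𝓕 0, …, 𝓕 (l - 1)` are mutually comparable. -/
def MutuallyComparable {n l : ℕ} (𝓕 : Fin l → Finset (BoolLattice n)) : Prop :=
  ∀ i j : Fin l, i < j → ∀ F ∈ 𝓕 i, ∀ G ∈ 𝓕 j, F ⊆ G ∨ G ⊆ F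

/-- `∅ = S 0 ⊆ S 1 ⊆ ⋯ ⊆ S m = [n]` is a core chain of the pairwise disjoint families `𝓕 i`: every
member of the families lies in one of the subcubes `[S j, S (j + 1)]`, and no truncated subcube
(the subcube without its smallest and its largest element) contains members of two different
families. -/
structure IsCoreChain {n l m : ℕ} (𝓕 : Fin l → Finset (BoolLattice n))
    (S : Fin (m + 1) → BoolLattice n) : Prop where
  disjoint : ∀ i i' : Fin l, i ≠ i' → Disjoint (𝓕 i) (𝓕 i')
  bot : S 0 = ∅
  top : S (Fin.last m) = Finset.univ
  step : ∀ j : Fin m, S j.castSucc ⊆ S j.succ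
  cover : ∀ i : Fin l, ∀ F ∈ 𝓕 i, ∃ j : Fin m, F ∈ Finset.Icc (S j.castSucc) (S j.succ)
  truncated : ∀ j : Fin m, ∀ i i' : Fin l, i ≠ i' →
    ∀ F ∈ 𝓕 i, ∀ G ∈ 𝓕 i', F ∈ Finset.Ioo (S j.castSucc) (S j.succ) →
      G ∉ Finset.Ioo (S j.castSucc) (S j.succ)

end RainbowBoolean

namespace RainbowBoolean

/-! A coloring without a rainbow antichain is a pair of disjoint, mutually comparable families F, G.
Call S a cut if it is comparable to every member of F ∪ G. A connected component of the
incomparability graph on F ∪ G lies inside one family, and its union is a cut. Hence an interval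
between two cuts whose interior meets both families has a further cut in its interior
(`exists_isCut_mem_Ioo`). Refining ∅ ⊆ [n] in this way yields, for every level t < n, cuts A ⊆ B
with |A| ≤ t < |B| such that the interior of [A, B] misses one family (`exists_isGap`).

The family missing there lies in the outer cubes [∅, A] ∪ [B, [n]], which bounds the minimum. Both
families together lie in the outer cubes and the interior, which bounds twice the minimum. If A and
B avoid the middle levels, convexity of powers of 2 turns these bounds into 2^(⌊n/2⌋-1) + 4;
consecutive members of a core chain form such a pair, which is (ii). For (i), a cut on a middle
level is the main case.

For (iii) the same two bounds are used with Lubell masses of subcubes, which have a closed form. The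
critical configuration has a single cut S, at relative height 1/√2 up to complementation.

The lower bounds use one cut S: (∅, S] against (S, [n]] for even n, and (∅, S) against {∅} ∪ [S,
[n]] for odd n and for Lubell mass. -/

/-! ### Cuts and gaps of a mutually comparable pair -/

/-- `S` is comparable to every member of `U`. -/
def IsCut {n : ℕ} (U : Finset (BoolLattice n)) (S : BoolLattice n) : Prop :=
  ∀ X ∈ U, X ⊆ S ∨ S ⊆ X

/-- Every member of `F` is comparable to every member of `G`. -/
def CrossComparable {n : ℕ} (F G : Finset (BoolLattice n)) : Prop :=
  ∀ X ∈ F, ∀ Y ∈ G, X ⊆ Y ∨ Y ⊆ X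

theorem CrossComparable.symm {n : ℕ} {F G : Finset (BoolLattice n)} (h : CrossComparable F G) :
    CrossComparable G F := fun X hX Y hY => (h Y hY X hX).symm

/-- The cut is the union of a connected component of the incomparability graph. -/
theorem exists_isCut_mem_Ioo_of_subset {n : ℕ} {F G : Finset (BoolLattice n)}
    (h : CrossComparable F G) (hd : Disjoint F G) {A B f g : BoolLattice n}
    (hf : f ∈ F) (hg : g ∈ G) (hfI : f ∈ Finset.Ioo A B) (hgI : g ∈ Finset.Ioo A B)
    (hfg : f ⊆ g) : ∃ T ∈ Finset.Ioo A B, IsCut (F ∪ G) T := by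
  classical
  let r : BoolLattice n → BoolLattice n → Prop := fun x y => y ∈ F ∪ G ∧ ¬ (x ⊆ y ∨ y ⊆ x)
  let C : BoolLattice n → Prop := Relation.ReflTransGen r f
  have hCF : ∀ y, C y → y ∈ F := by
    intro y hy
    induction hy with
    | refl => exact hf
    | tail _ hr ih =>
      rcases Finset.mem_union.1 hr.1 with hF | hG
      · exact hF
      · exact absurd (h _ ih _ hG) hr.2
  -- A set u outside the component is comparable to each of its members. Along an edge y, z with y ⊆
  -- u, having u ⊆ z would give y ⊆ z, so the inclusion in u propagates.
  have hup : ∀ u ∈ F ∪ G, ¬ C u → f ⊆ u → ∀ y, C y → y ⊆ u := by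
    intro u hu hCu hfu y hy
    induction hy with
    | refl => exact hfu
    | @tail y z hy hr ih =>
      by_contra hzu
      have huz : u ⊆ z := by
        by_contra huz
        exact hCu ((hy.tail hr).tail ⟨hu, by tauto⟩)
      exact hr.2 (Or.inl (ih.trans huz))
  let T : BoolLattice n := (Finset.univ.filter C).sup id
  have hT : ∀ y, C y → y ⊆ T := fun y hy =>
    Finset.le_sup (f := id) (Finset.mem_filter.2 ⟨Finset.mem_univ y, hy⟩)
  have hTu : ∀ u ∈ F ∪ G, ¬ C u → f ⊆ u → T ⊆ u := by
    intro u hu hCu hfu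
    refine Finset.sup_le (f := id) fun y hy => ?_
    exact hup u hu hCu hfu y (Finset.mem_filter.1 hy).2
  have hgC : ¬ C g := fun hg' => Finset.disjoint_left.1 hd (hCF g hg') hg
  rw [Finset.mem_Ioo] at hfI hgI
  refine ⟨T, Finset.mem_Ioo.2 ⟨hfI.1.trans_le (hT f .refl), lt_of_le_of_lt
    (hTu g (Finset.mem_union_right _ hg) hgC hfg) hgI.2⟩, fun u hu => ?_⟩
  by_cases hCu : C u
  · exact Or.inl (hT u hCu)
  by_cases hfu : f ⊆ u
  · exact Or.inr (hTu u hu hCu hfu)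
  · refine Or.inl (subset_trans ?_ (hT f .refl))
    by_contra huf
    exact hCu (Relation.ReflTransGen.single ⟨hu, by tauto⟩)

theorem exists_isCut_mem_Ioo {n : ℕ} {F G : Finset (BoolLattice n)}
    (h : CrossComparable F G) (hd : Disjoint F G) {A B : BoolLattice n}
    (hF : ∃ f ∈ F, f ∈ Finset.Ioo A B) (hG : ∃ g ∈ G, g ∈ Finset.Ioo A B) :
    ∃ T ∈ Finset.Ioo A B, IsCut (F ∪ G) T := by
  obtain ⟨f, hf, hfI⟩ := hF
  obtain ⟨g, hg, hgI⟩ := hG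
  rcases h f hf g hg with hfg | hgf
  · exact exists_isCut_mem_Ioo_of_subset h hd hf hg hfI hgI hfg
  · rw [Finset.union_comm]
    exact exists_isCut_mem_Ioo_of_subset h.symm hd.symm hg hf hgI hfI hgf

/-- `A ⊆ B` are cuts, and the truncated subcube between them misses one of the families. -/
structure IsGap {n : ℕ} (F G : Finset (BoolLattice n)) (A B : BoolLattice n) : Prop where
  subset : A ⊆ B
  cut_left : IsCut (F ∪ G) A
  cut_right : IsCut (F ∪ G) B
  mono : (∀ X ∈ F, X ∉ Finset.Ioo A B) ∨ (∀ X ∈ G, X ∉ Finset.Ioo A B)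

/-- Bisection: as long as the interior of [A, B] meets both families it contains a cut, which
replaces the endpoint on its own side of level t. -/
theorem exists_isGap {n : ℕ} {F G : Finset (BoolLattice n)}
    (h : CrossComparable F G) (hd : Disjoint F G) {t : ℕ} (ht : t < n) :
    ∃ A B : BoolLattice n, IsGap F G A B ∧ A.card ≤ t ∧ t < B.card := by
  suffices H : ∀ k : ℕ, ∀ A B : BoolLattice n, B.card - A.card = k → A ⊆ B → IsCut (F ∪ G) A →
      IsCut (F ∪ G) B → A.card ≤ t → t < B.card →
      ∃ A B : BoolLattice n, IsGap F G A B ∧ A.card ≤ t ∧ t < B.card from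
    H _ ∅ Finset.univ rfl (Finset.empty_subset _) (fun X _ => Or.inr (Finset.empty_subset X))
      (fun X _ => Or.inl (Finset.subset_univ X)) (by simp) (by simpa using ht)
  intro k
  induction k using Nat.strong_induction_on with
  | _ k ih =>
    intro A B hk hAB hA hB hAt hBt
    by_cases hm : (∀ X ∈ F, X ∉ Finset.Ioo A B) ∨ (∀ X ∈ G, X ∉ Finset.Ioo A B)
    · exact ⟨A, B, ⟨hAB, hA, hB, hm⟩, hAt, hBt⟩
    · push Not at hm
      obtain ⟨T, hT, hcut⟩ := exists_isCut_mem_Ioo h hd hm.1 hm.2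
      rw [Finset.mem_Ioo] at hT
      have h1 := Finset.card_lt_card hT.1
      have h2 := Finset.card_lt_card hT.2
      rcases le_or_gt T.card t with hTt | hTt
      · exact ih _ (by omega) T B rfl hT.2.le hcut hB hTt hBt
      · exact ih _ (by omega) A T rfl hT.1.le hA hcut hAt hTt

theorem IsGap.mem_or {n : ℕ} {F G : Finset (BoolLattice n)} {A B : BoolLattice n}
    (h : IsGap F G A B) {X : BoolLattice n} (hX : X ∈ F ∪ G) :
    X ∈ Finset.Icc ∅ A ∨ X ∈ Finset.Ioo A B ∨ X ∈ Finset.Icc B Finset.univ := by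
  simp only [Finset.mem_Icc, Finset.mem_Ioo, Finset.empty_subset,
    Finset.subset_univ, true_and, and_true]
  by_cases h1 : X ⊆ A
  · exact Or.inl h1
  by_cases h2 : B ⊆ X
  · exact Or.inr (Or.inr h2)
  exact Or.inr (Or.inl ⟨lt_of_le_not_ge ((h.cut_left X hX).resolve_left h1) h1,
    lt_of_le_not_ge ((h.cut_right X hX).resolve_right h2) h2⟩)

theorem IsGap.union_subset {n : ℕ} {F G : Finset (BoolLattice n)} {A B : BoolLattice n}
    (h : IsGap F G A B) :
    F ∪ G ⊆ (Finset.Icc ∅ A ∪ Finset.Icc B Finset.univ) ∪ Finset.Ioo A B := by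
  intro X hX
  have := h.mem_or hX
  simp only [Finset.mem_union]
  tauto

theorem IsGap.subset_outer {n : ℕ} {F G : Finset (BoolLattice n)} {A B : BoolLattice n}
    (h : IsGap F G A B) :
    F ⊆ Finset.Icc ∅ A ∪ Finset.Icc B Finset.univ ∨
      G ⊆ Finset.Icc ∅ A ∪ Finset.Icc B Finset.univ := by
  refine h.mono.imp (fun hm X hX => ?_) (fun hm X hX => ?_)
  · have := h.mem_or (Finset.mem_union_left G hX)
    have := hm X hX
    simp only [Finset.mem_union]
    tauto
  · have := h.mem_or (Finset.mem_union_right F hX)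
    have := hm X hX
    simp only [Finset.mem_union]
    tauto

/-! ### Cardinality bounds from cuts and gaps -/

theorem card_outer_le {n : ℕ} (A B : BoolLattice n) :
    (Finset.Icc ∅ A ∪ Finset.Icc B Finset.univ).card ≤ 2 ^ A.card + 2 ^ (n - B.card) := by
  refine (Finset.card_union_le _ _).trans ?_
  rw [Finset.card_Icc_finset (Finset.empty_subset A), Finset.card_Icc_finset (Finset.subset_univ B)]
  simp

theorem IsGap.min_card_le {n : ℕ} {F G : Finset (BoolLattice n)} {A B : BoolLattice n}
    (h : IsGap F G A B) : min F.card G.card ≤ 2 ^ A.card + 2 ^ (n - B.card) := by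
  rcases h.subset_outer with hs | hs
  · exact (min_le_left _ _).trans ((Finset.card_le_card hs).trans (card_outer_le A B))
  · exact (min_le_right _ _).trans ((Finset.card_le_card hs).trans (card_outer_le A B))

theorem IsGap.card_add_card_le {n : ℕ} {F G : Finset (BoolLattice n)} {A B : BoolLattice n}
    (h : IsGap F G A B) (hd : Disjoint F G) :
    F.card + G.card ≤ 2 ^ A.card + 2 ^ (n - B.card) + (2 ^ (B.card - A.card) - 2) := by
  rw [← Finset.card_union_of_disjoint hd]
  refine (Finset.card_le_card h.union_subset).trans ((Finset.card_union_le _ _).trans ?_)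
  rw [Finset.card_Ioo_finset h.subset]
  exact Nat.add_le_add_right (card_outer_le A B) _

theorem IsCut.card_add_card_le {n : ℕ} {F G : Finset (BoolLattice n)} {S : BoolLattice n}
    (h : IsCut (F ∪ G) S) (hd : Disjoint F G) :
    F.card + G.card ≤ 2 ^ S.card + 2 ^ (n - S.card) - 1 := by
  rw [← Finset.card_union_of_disjoint hd]
  have hsub : F ∪ G ⊆ Finset.Icc ∅ S ∪ Finset.Ioc S Finset.univ := by
    intro X hX
    simp only [Finset.mem_union, Finset.mem_Icc, Finset.mem_Ioc,
      Finset.empty_subset, Finset.subset_univ, true_and, and_true]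
    by_cases h1 : X ⊆ S
    · exact Or.inl h1
    · exact Or.inr (lt_of_le_not_ge ((h X hX).resolve_left h1) h1)
  refine (Finset.card_le_card hsub).trans ((Finset.card_union_le _ _).trans ?_)
  rw [Finset.card_Icc_finset (Finset.empty_subset S), Finset.card_Ioc_finset (Finset.subset_univ S)]
  have := Nat.one_le_two_pow (n := n - S.card)
  simp
  omega

/-- Convexity of powers of 2, in the form (2^i - 1)(2^j - 1) ≥ 0. -/
theorem two_pow_add_two_pow_le (p i j : ℕ) : 2 ^ (p + i) + 2 ^ (p + j) ≤ 2 ^ p + 2 ^ (p + i + j) := by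
  have hi := Nat.one_le_two_pow (n := i)
  have hj := Nat.one_le_two_pow (n := j)
  have : 2 ^ i + 2 ^ j ≤ 1 + 2 ^ i * 2 ^ j := by nlinarith
  simp only [pow_add]
  nlinarith [Nat.one_le_two_pow (n := p)]

/-- The numerical heart of the bound for core chains avoiding the middle. -/
theorem le_of_le_of_two_mul_le {f a c d x : ℕ} (ha : a < f) (hc : c < f)
    (hn : a + c + d = 2 * f ∨ a + c + d = 2 * f + 1)
    (h1 : x ≤ 2 ^ a + 2 ^ c) (h2 : 2 * x ≤ 2 ^ a + 2 ^ c + (2 ^ d - 2)) :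
    x ≤ 2 ^ (f - 1) + 4 := by
  wlog hca : c ≤ a generalizing a c
  · exact this hc ha (by omega) (by omega) (by omega) (by omega)
  obtain ⟨g, rfl⟩ : ∃ g, f = g + 1 := ⟨f - 1, by omega⟩
  simp only [Nat.add_sub_cancel]
  rcases Nat.lt_or_ge a g with hag | hag
  · have e1 : 2 ^ a ≤ 2 ^ (g - 1) := Nat.pow_le_pow_right (by norm_num) (by omega)
    -- Here c ≤ a < g, so `h1` alone gives x ≤ 2^g.
    have e2 : 2 ^ c ≤ 2 ^ (g - 1) := Nat.pow_le_pow_right (by norm_num) (by omega)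
    have e3 : 2 ^ g = 2 * 2 ^ (g - 1) := by rw [← pow_succ']; congr 1; omega
    omega
  -- If c ≤ 2, then `h1` gives x ≤ 2^a + 4, the source of the constant 4. Otherwise c + d is a + 2
  -- or a + 3, and convexity bounds 2^c + 2^d by 2^a + 4 or 2^a + 8, so that `h2` suffices.
  obtain rfl : a = g := by omega
  rcases Nat.lt_or_ge c 3 with hc3 | hc3
  · have : 2 ^ c ≤ 2 ^ 2 := Nat.pow_le_pow_right (by norm_num) (by omega)
    omega
  have hd2 : 2 ^ 1 ≤ 2 ^ d := Nat.pow_le_pow_right (by norm_num) (by omega)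
  rcases hn with hn | hn
  · have := two_pow_add_two_pow_le 2 (c - 2) (d - 2)
    rw [show 2 + (c - 2) = c by omega, show 2 + (d - 2) = d by omega,
      show c + (d - 2) = a by omega] at this
    omega
  · have := two_pow_add_two_pow_le 3 (c - 3) (d - 3)
    rw [show 3 + (c - 3) = c by omega, show 3 + (d - 3) = d by omega,
      show c + (d - 3) = a by omega] at this
    omega

theorem IsGap.min_card_le_of_avoids {n : ℕ} {F G : Finset (BoolLattice n)} {A B : BoolLattice n}
    (h : IsGap F G A B) (hd : Disjoint F G) (hA : A.card < n / 2) (hB : (n + 1) / 2 < B.card) :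
    min F.card G.card ≤ 2 ^ (n / 2 - 1) + 4 := by
  have hBn : B.card ≤ n := by simpa using Finset.card_le_univ B
  have h2 := h.card_add_card_le hd
  exact le_of_le_of_two_mul_le (a := A.card) (c := n - B.card) (d := B.card - A.card) hA (by omega)
    (by omega) h.min_card_le (by omega)

/-! ### Core chains -/

/-- Every chain member is a cut, because each set of the families lies between two consecutive chain
members. The step of the chain that crosses level t is therefore a gap. -/
theorem IsCoreChain.exists_isGap {n m : ℕ} {𝓕 : Fin 2 → Finset (BoolLattice n)}
    {S : Fin (m + 1) → BoolLattice n} (h : IsCoreChain 𝓕 S) {t : ℕ} (ht : t < n) :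
    ∃ i j, IsGap (𝓕 0) (𝓕 1) (S i) (S j) ∧ (S i).card ≤ t ∧ t < (S j).card := by
  have hmono : Monotone S := Fin.monotone_iff_le_succ.2 h.step
  obtain ⟨j, hj1, hj2⟩ : ∃ j : Fin m, (S j.castSucc).card ≤ t ∧ t < (S j.succ).card := by
    by_contra! hcon
    have : ∀ j : Fin (m + 1), (S j).card ≤ t := by
      intro j
      induction j using Fin.induction with
      | zero => simp [h.bot]
      | succ j ih => exact hcon j ih
    have := this (Fin.last m)
    rw [h.top] at this
    simp at this
    omega
  have hcomp : ∀ X ∈ 𝓕 0 ∪ 𝓕 1, ∃ i : Fin m, X ∈ Finset.Icc (S i.castSucc) (S i.succ) := by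
    intro X hX
    rcases Finset.mem_union.1 hX with hX | hX <;> exact h.cover _ X hX
  have hcut : ∀ k : Fin (m + 1), IsCut (𝓕 0 ∪ 𝓕 1) (S k) := by
    intro k X hX
    obtain ⟨i, hi⟩ := hcomp X hX
    rw [Finset.mem_Icc] at hi
    rcases le_or_gt k i.castSucc with hk | hk
    · exact Or.inr ((hmono hk).trans hi.1)
    · exact Or.inl (hi.2.trans (hmono (Fin.castSucc_lt_iff_succ_le.1 hk)))
  refine ⟨j.castSucc, j.succ, ⟨h.step j, hcut _, hcut _, ?_⟩, hj1, hj2⟩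
  by_contra! hcon
  obtain ⟨⟨X, hX, hXI⟩, Y, hY, hYI⟩ := hcon
  exact h.truncated j 0 1 (by decide) X hX Y hY hXI hYI

theorem IsCoreChain.min_card_le {n m : ℕ} {𝓕 : Fin 2 → Finset (BoolLattice n)}
    {S : Fin (m + 1) → BoolLattice n} (h : IsCoreChain 𝓕 S)
    (hS : ∀ j, (S j).card ≠ n / 2 ∧ (S j).card ≠ (n + 1) / 2) :
    ((min (𝓕 0).card (𝓕 1).card : ℕ) : ℝ) ≤ (2 : ℝ) ^ (((n / 2 : ℕ) : ℤ) - 1) + 4 := by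
  -- The chain starts at ∅, of size 0, so the avoided size ⌊n/2⌋ is positive.
  have hn : 2 ≤ n := by
    have := (hS 0).1
    rw [h.bot] at this
    simp at this
    omega
  obtain ⟨i, j, hg, hi, hj⟩ := h.exists_isGap (t := n / 2) (by omega)
  have := hg.min_card_le_of_avoids (h.disjoint 0 1 (by decide)) (by have := (hS i).1; omega)
    (by have := (hS j).2; omega)
  rw [show ((n / 2 : ℕ) : ℤ) - 1 = ((n / 2 - 1 : ℕ) : ℤ) by omega, zpow_natCast]
  exact_mod_cast this

/-! ### Upper bounds for the smaller cardinality -/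

theorem min_card_le_of_even {n : ℕ} {F G : Finset (BoolLattice n)} (h : CrossComparable F G)
    (hd : Disjoint F G) (hn : Even n) (hn2 : n ≠ 2) : min F.card G.card ≤ 2 ^ (n / 2) - 1 := by
  obtain ⟨f, rfl⟩ := hn
  have e : (f + f) / 2 = f := by omega
  rw [e]
  have hp := Nat.one_le_two_pow (n := f)
  rcases Nat.eq_zero_or_pos f with rfl | hf
  · have : (F ∪ G).card ≤ 1 := (Finset.card_le_univ _).trans (by simp)
    rw [Finset.card_union_of_disjoint hd] at this
    simp only [pow_zero]
    omega
  obtain ⟨A, B, hg, hA, hB⟩ := exists_isGap h hd (t := f) (by omega)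
  -- A cut on the middle level bounds the sum by 2·2^f - 1, so the minimum is at most 2^f - 1.
  rcases eq_or_lt_of_le hA with hA | hA
  · have := hg.cut_left.card_add_card_le hd
    rw [hA, show f + f - f = f by omega] at this
    omega
  have hBn : B.card ≤ f + f := by simpa using Finset.card_le_univ B
  have h1 := hg.min_card_le
  have h2 := hg.card_add_card_le hd
  have h3 := hg.min_card_le_of_avoids hd (by omega) (by omega)
  rw [e] at h3
  -- From f = 4 on, 2^(f-1) + 4 ≤ 2^f - 1; smaller f are checked directly. At f = 1 the bound fails
  -- ({∅, [2]} against the two singletons), which is the excluded n = 2.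
  rcases Nat.lt_or_ge f 4 with hf4 | hf4
  · generalize F.card = x at *
    generalize G.card = y at *
    generalize A.card = a at *
    generalize B.card = b at *
    interval_cases f <;> interval_cases a <;> interval_cases b <;> norm_num at * <;> omega
  · have e3 : 2 ^ f = 2 * 2 ^ (f - 1) := by rw [← pow_succ']; congr 1; omega
    have : 2 ^ 3 ≤ 2 ^ (f - 1) := Nat.pow_le_pow_right (by norm_num) (by omega)
    omega

theorem IsGap.of_cut_univ {n : ℕ} {F G : Finset (BoolLattice n)} {S : BoolLattice n}
    (h : IsCut (F ∪ G) S) (hm : ¬ ((∃ X ∈ F, X ∈ Finset.Ioo S Finset.univ) ∧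
      ∃ X ∈ G, X ∈ Finset.Ioo S Finset.univ)) : IsGap F G S Finset.univ :=
  ⟨Finset.subset_univ S, h, fun X _ => Or.inl (Finset.subset_univ X), by
    by_contra! hc; exact hm hc⟩

theorem IsGap.of_empty_cut {n : ℕ} {F G : Finset (BoolLattice n)} {S : BoolLattice n}
    (h : IsCut (F ∪ G) S) (hm : ¬ ((∃ X ∈ F, X ∈ Finset.Ioo ∅ S) ∧
      ∃ X ∈ G, X ∈ Finset.Ioo ∅ S)) : IsGap F G ∅ S :=
  ⟨Finset.empty_subset S, fun X _ => Or.inr (Finset.empty_subset X), h, by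
    by_contra! hc; exact hm hc⟩

/-- Two nested cuts bound the number of members. -/
theorem card_add_card_le_of_ssubset {n : ℕ} {F G : Finset (BoolLattice n)} {S T : BoolLattice n}
    (hS : IsCut (F ∪ G) S) (hT : IsCut (F ∪ G) T) (hST : S ⊆ T) (hd : Disjoint F G) :
    F.card + G.card ≤ 2 ^ S.card + 2 ^ (n - T.card) + (2 ^ (T.card - S.card) - 2) := by
  rw [← Finset.card_union_of_disjoint hd]
  -- Putting all sets into one family makes the requirement on the interior vacuous.
  have hg : IsGap (F ∪ G) ∅ S T := ⟨hST, by simpa using hS, by simpa using hT, by simp⟩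
  simpa using hg.card_add_card_le (by simp)

/-- Let n = 2f + 1 and let A be a cut of size f. If both families meet the interior of [A, [n]], a
second cut there brings the sum down to 2·2^f by convexity. If not, [A, [n]] is itself a gap and the
minimum is at most 2^f + 1. A cut of size f + 1 is treated dually, and gaps avoiding both middle
levels give less. -/
theorem min_card_le_of_odd {n : ℕ} {F G : Finset (BoolLattice n)} (h : CrossComparable F G)
    (hd : Disjoint F G) (hn : Odd n) (hn5 : 5 ≤ n) : min F.card G.card ≤ 2 ^ (n / 2) + 1 := by
  obtain ⟨f, rfl⟩ := hn
  have e : (2 * f + 1) / 2 = f := by omega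
  rw [e]
  have conv : ∀ i j : ℕ, 1 ≤ i → 1 ≤ j → i + j = f + 1 → 2 ^ i + 2 ^ j ≤ 2 + 2 ^ f := by
    intro i j hi hj hij
    have := two_pow_add_two_pow_le 1 (i - 1) (j - 1)
    rwa [show 1 + (i - 1) = i by omega, show 1 + (j - 1) = j by omega,
      show i + (j - 1) = f by omega, pow_one] at this
  obtain ⟨A, B, hg, hA, hB⟩ := exists_isGap h hd (t := f) (by omega)
  have hBn : B.card ≤ 2 * f + 1 := by simpa using Finset.card_le_univ B
  rcases eq_or_lt_of_le hA with hA | hA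
  · by_cases hm : (∃ X ∈ F, X ∈ Finset.Ioo A Finset.univ) ∧ ∃ X ∈ G, X ∈ Finset.Ioo A Finset.univ
    · obtain ⟨T, hT, hcut⟩ := exists_isCut_mem_Ioo h hd hm.1 hm.2
      rw [Finset.mem_Ioo] at hT
      have l1 := Finset.card_lt_card hT.1
      have l2 := Finset.card_lt_card hT.2
      simp only [Finset.card_univ, Fintype.card_fin] at l2
      have h2 := card_add_card_le_of_ssubset hg.cut_left hcut hT.1.le hd
      have h3 := conv (2 * f + 1 - T.card) (T.card - A.card) (by omega) (by omega) (by omega)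
      have h4 : 2 ^ 1 ≤ 2 ^ (T.card - A.card) := Nat.pow_le_pow_right (by norm_num) (by omega)
      rw [hA] at h2 h3 h4
      omega
    · have := (IsGap.of_cut_univ hg.cut_left hm).min_card_le
      simpa [hA] using this
  rcases eq_or_lt_of_le (Nat.succ_le_of_lt hB) with hB | hB
  · by_cases hm : (∃ X ∈ F, X ∈ Finset.Ioo ∅ B) ∧ ∃ X ∈ G, X ∈ Finset.Ioo ∅ B
    · obtain ⟨T, hT, hcut⟩ := exists_isCut_mem_Ioo h hd hm.1 hm.2
      rw [Finset.mem_Ioo] at hT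
      have l1 := Finset.card_lt_card hT.1
      have l2 := Finset.card_lt_card hT.2
      simp only [Finset.card_empty] at l1
      have h2 := card_add_card_le_of_ssubset hcut hg.cut_right hT.2.le hd
      have h3 := conv T.card (B.card - T.card) (by omega) (by omega) (by omega)
      have h4 : 2 ^ 1 ≤ 2 ^ (B.card - T.card) := Nat.pow_le_pow_right (by norm_num) (by omega)
      rw [show 2 * f + 1 - B.card = f by omega] at h2
      omega
    · have := (IsGap.of_empty_cut hg.cut_right hm).min_card_le
      rw [show 2 * f + 1 - B.card = f by omega] at this
      simpa [add_comm] using this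
  have h1 := hg.min_card_le
  have h3 := hg.min_card_le_of_avoids hd (by omega) (by omega)
  rw [e] at h3
  rcases Nat.lt_or_ge f 3 with hf3 | hf3
  · obtain rfl : f = 2 := by omega
    have e1 : 2 ^ A.card ≤ 2 ^ 1 := Nat.pow_le_pow_right (by norm_num) (by omega)
    have e2 : 2 ^ (2 * 2 + 1 - B.card) ≤ 2 ^ 1 := Nat.pow_le_pow_right (by norm_num) (by omega)
    omega
  · have e3 : 2 ^ f = 2 * 2 ^ (f - 1) := by rw [← pow_succ']; congr 1; omega
    have : 2 ^ 2 ≤ 2 ^ (f - 1) := Nat.pow_le_pow_right (by norm_num) (by omega)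
    omega

/-! ### From colorings to pairs of families -/

theorem admitsRainbowAntichain_iff {n : ℕ} (φ : PartialColoring n 2) :
    φ.AdmitsRainbowAntichain ↔ ¬ CrossComparable (φ.colorClass 0) (φ.colorClass 1) := by
  classical
  simp only [CrossComparable, PartialColoring.colorClass, Finset.mem_filter, Finset.mem_univ,
    true_and]
  push Not
  constructor
  · rintro ⟨X, ⟨α, hα⟩, hcol, hne⟩
    have key : ∀ i j : Fin 2, i ≠ j → ¬ ((α ⟨i⟩ : BoolLattice n) ⊆ α ⟨j⟩) := by
      intro i j hij hs
      have : (⟨i⟩ : AntichainPoset 2) = ⟨j⟩ := (hα ⟨i⟩ ⟨j⟩).2 hs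
      exact hij (congrArg AntichainPoset.idx this)
    have h01 := key 0 1 (by decide)
    have h10 := key 1 0 (by decide)
    have hd := hne _ (α ⟨0⟩).2 _ (α ⟨1⟩).2 (fun h => h01 h.subset)
    obtain ⟨a, ha⟩ := Option.ne_none_iff_exists'.1 (hcol _ (α ⟨0⟩).2)
    obtain ⟨b, hb⟩ := Option.ne_none_iff_exists'.1 (hcol _ (α ⟨1⟩).2)
    rw [ha, hb] at hd
    fin_cases a <;> fin_cases b
    · simp at hd
    · exact ⟨_, ha, _, hb, h01, h10⟩
    · exact ⟨_, hb, _, ha, h10, h01⟩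
    · simp at hd
  · rintro ⟨F, hF, G, hG, hFG, hGF⟩
    have hne : F ≠ G := fun h => hFG h.subset
    let v : AntichainPoset 2 → BoolLattice n := fun p => if p.idx = 0 then F else G
    have hv : ∀ p q, v p ⊆ v q → p = q := by
      rintro ⟨i⟩ ⟨j⟩ h
      fin_cases i <;> fin_cases j <;> simp_all [v]
    refine ⟨Set.range v, ⟨Equiv.ofInjective v fun p q h => hv p q h.subset, fun p q => ?_⟩, ?_, ?_⟩
    · constructor
      · rintro (rfl : p = q)
        exact le_rfl
      · exact fun h => hv p q h
    · rintro _ ⟨⟨i⟩, rfl⟩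
      fin_cases i <;> simp [v, hF, hG]
    · rintro _ ⟨⟨i⟩, rfl⟩ _ ⟨⟨j⟩, rfl⟩ h
      fin_cases i <;> fin_cases j <;> simp_all [v]

theorem disjoint_colorClass {n k : ℕ} (φ : PartialColoring n k) {i j : Fin k} (h : i ≠ j) :
    Disjoint (φ.colorClass i) (φ.colorClass j) := by
  refine Finset.disjoint_left.2 fun X hi hj => h ?_
  simp only [PartialColoring.colorClass, Finset.mem_filter, Finset.mem_univ, true_and] at hi hj
  exact Option.some.inj (hi.symm.trans hj)

theorem exists_colorClass_eq {n : ℕ} {F G : Finset (BoolLattice n)} (hd : Disjoint F G) :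
    ∃ φ : PartialColoring n 2, φ.colorClass 0 = F ∧ φ.colorClass 1 = G := by
  classical
  refine ⟨fun X => if X ∈ F then some 0 else if X ∈ G then some 1 else none, ?_, ?_⟩
  · ext X
    by_cases hF : X ∈ F <;> simp [PartialColoring.colorClass, hF]
  · ext X
    by_cases hF : X ∈ F
    · simp [PartialColoring.colorClass, hF, Finset.disjoint_left.1 hd hF]
    · by_cases hG : X ∈ G <;> simp [PartialColoring.colorClass, hF, hG]

theorem FPrime_two_eq {n M : ℕ}
    (hup : ∀ F G : Finset (BoolLattice n), CrossComparable F G → Disjoint F G →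
      min F.card G.card ≤ M)
    (hlow : ∃ F G : Finset (BoolLattice n), CrossComparable F G ∧ Disjoint F G ∧
      M ≤ F.card ∧ M ≤ G.card) : FPrime n 2 = M + 1 := by
  refine le_antisymm (Nat.sInf_le fun φ hφ => ?_) (le_csInf ⟨M + 1, fun φ hφ => ?_⟩ fun m hm => ?_)
  any_goals
    rw [admitsRainbowAntichain_iff]
    intro hc
    have := hup _ _ hc (disjoint_colorClass φ (by decide))
    have := hφ 0
    have := hφ 1
    omega
  obtain ⟨F, G, hc, hd, hF, hG⟩ := hlow
  obtain ⟨φ, h0, h1⟩ := exists_colorClass_eq hd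
  by_contra hlt
  have := hm φ (by intro i; fin_cases i <;> simp [h0, h1] <;> omega)
  rw [admitsRainbowAntichain_iff, h0, h1] at this
  exact this hc

theorem admits_of_lt_lubellMass {n : ℕ} {c γ : ℝ}
    (hup : ∀ F G : Finset (BoolLattice n), CrossComparable F G → Disjoint F G →
      min (lubellMass F) (lubellMass G) ≤ c) (hγ : c < γ) (φ : PartialColoring n 2)
    (hφ : ∀ i : Fin 2, γ ≤ lubellMass (φ.colorClass i)) : φ.AdmitsRainbowAntichain := by
  rw [admitsRainbowAntichain_iff]
  intro hc
  have := hup _ _ hc (disjoint_colorClass φ (by decide))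
  have := le_min (hφ 0) (hφ 1)
  linarith

theorem not_admits_of_le {n : ℕ} {c : ℝ} {F G : Finset (BoolLattice n)} (hc : CrossComparable F G)
    (hd : Disjoint F G) (hF : c ≤ lubellMass F) (hG : c ≤ lubellMass G) {γ : ℝ}
    (hγ : ∀ φ : PartialColoring n 2,
      (∀ i : Fin 2, γ ≤ lubellMass (φ.colorClass i)) → φ.AdmitsRainbowAntichain) : c ≤ γ := by
  obtain ⟨φ, h0, h1⟩ := exists_colorClass_eq hd
  by_contra hlt
  have := hγ φ (by intro i; fin_cases i <;> simp [h0, h1] <;> linarith)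
  rw [admitsRainbowAntichain_iff, h0, h1] at this
  exact this hc

theorem GPrime_two_le {n : ℕ} {c : ℝ}
    (hup : ∀ F G : Finset (BoolLattice n), CrossComparable F G → Disjoint F G →
      min (lubellMass F) (lubellMass G) ≤ c) : GPrime n 2 ≤ c := by
  refine le_of_forall_gt_imp_ge_of_dense fun γ hγ => csInf_le ⟨0, fun γ' h => ?_⟩
    (admits_of_lt_lubellMass hup hγ)
  exact not_admits_of_le (F := ∅) (G := ∅) (by simp [CrossComparable]) (by simp)
    (by simp [lubellMass]) (by simp [lubellMass]) h

theorem lubellMass_nonneg {n : ℕ} (F : Finset (BoolLattice n)) : 0 ≤ lubellMass F :=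
  Finset.sum_nonneg fun _ _ => by positivity

theorem lubellMass_mono {n : ℕ} {F G : Finset (BoolLattice n)} (h : F ⊆ G) :
    lubellMass F ≤ lubellMass G :=
  Finset.sum_le_sum_of_subset_of_nonneg h fun _ _ _ => by positivity

theorem lubellMass_union {n : ℕ} {F G : Finset (BoolLattice n)} (h : Disjoint F G) :
    lubellMass (F ∪ G) = lubellMass F + lubellMass G :=
  Finset.sum_union h

theorem lubellMass_union_le {n : ℕ} (F G : Finset (BoolLattice n)) :
    lubellMass (F ∪ G) ≤ lubellMass F + lubellMass G := by
  have : lubellMass (F ∪ G) + lubellMass (F ∩ G) = lubellMass F + lubellMass G :=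
    Finset.sum_union_inter
  linarith [lubellMass_nonneg (F ∩ G)]

theorem le_GPrime_two {n : ℕ} {c : ℝ} {F G : Finset (BoolLattice n)} (hc : CrossComparable F G)
    (hd : Disjoint F G) (hF : c ≤ lubellMass F) (hG : c ≤ lubellMass G) : c ≤ GPrime n 2 := by
  -- A γ above the mass of the whole lattice is admissible, so the infimum is over a nonempty set.
  refine le_csInf ⟨lubellMass (Finset.univ : Finset (BoolLattice n)) + 1, fun φ hφ => ?_⟩
    fun γ hγ => not_admits_of_le hc hd hF hG hγ
  exact admits_of_lt_lubellMass
    (fun F G _ _ => (min_le_left _ _).trans (lubellMass_mono (Finset.subset_univ F)))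
    (lt_add_one _) φ hφ

/-! ### Extremal pairs and the values of F' -/

theorem exists_card_eq {n k : ℕ} (h : k ≤ n) : ∃ S : BoolLattice n, S.card = k := by
  obtain ⟨S, _, hS⟩ := Finset.exists_subset_card_eq (s := (Finset.univ : BoolLattice n)) (n := k)
    (by simpa using h)
  exact ⟨S, hS⟩

theorem crossComparable_Ioc_Ioc {n : ℕ} (S : BoolLattice n) :
    CrossComparable (Finset.Ioc ∅ S) (Finset.Ioc S Finset.univ) := by
  intro X hX Y hY
  rw [Finset.mem_Ioc] at hX hY
  exact Or.inl (hX.2.trans hY.1.le)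

theorem disjoint_Ioc_Ioc {n : ℕ} (S : BoolLattice n) :
    Disjoint (Finset.Ioc ∅ S) (Finset.Ioc S Finset.univ) := by
  refine Finset.disjoint_left.2 fun X hX hY => ?_
  rw [Finset.mem_Ioc] at hX hY
  exact absurd hX.2 hY.1.not_ge

theorem crossComparable_Ioo_insert {n : ℕ} (S : BoolLattice n) :
    CrossComparable (Finset.Ioo ∅ S) (insert ∅ (Finset.Icc S Finset.univ)) := by
  intro X hX Y hY
  rw [Finset.mem_Ioo] at hX
  rw [Finset.mem_insert, Finset.mem_Icc] at hY
  rcases hY with rfl | hY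
  · exact Or.inr (Finset.empty_subset X)
  · exact Or.inl (hX.2.le.trans hY.1)

theorem disjoint_Ioo_insert {n : ℕ} (S : BoolLattice n) :
    Disjoint (Finset.Ioo ∅ S) (insert ∅ (Finset.Icc S Finset.univ)) := by
  refine Finset.disjoint_left.2 fun X hX hY => ?_
  rw [Finset.mem_Ioo] at hX
  rw [Finset.mem_insert, Finset.mem_Icc] at hY
  rcases hY with rfl | hY
  · exact lt_irrefl _ hX.1
  · exact absurd hY.1 hX.2.not_ge

theorem FPrime_two_of_even {n : ℕ} (hn : Even n) (hn2 : n ≠ 2) : FPrime n 2 = 2 ^ (n / 2) := by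
  have hp := Nat.one_le_two_pow (n := n / 2)
  obtain ⟨S, hS⟩ := exists_card_eq (Nat.div_le_self n 2)
  have := FPrime_two_eq (M := 2 ^ (n / 2) - 1)
    (fun F G h hd => min_card_le_of_even h hd hn hn2)
    ⟨_, _, crossComparable_Ioc_Ioc S, disjoint_Ioc_Ioc S, ?_, ?_⟩
  · omega
  · rw [Finset.card_Ioc_finset (Finset.empty_subset S)]
    simp [hS]
  · rw [Finset.card_Ioc_finset (Finset.subset_univ S)]
    obtain ⟨f, rfl⟩ := hn
    simp only [Finset.card_univ, Fintype.card_fin, hS]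
    rw [show f + f - (f + f) / 2 = (f + f) / 2 by omega]

theorem FPrime_two_of_odd {n : ℕ} (hn5 : 5 ≤ n) (hn : Odd n) :
    FPrime n 2 = 2 ^ (n / 2) + 2 := by
  obtain ⟨S, hS⟩ := exists_card_eq (show n / 2 + 1 ≤ n by omega)
  refine FPrime_two_eq (M := 2 ^ (n / 2) + 1) (fun F G h hd => min_card_le_of_odd h hd hn hn5)
    ⟨_, _, crossComparable_Ioo_insert S, disjoint_Ioo_insert S, ?_, ?_⟩
  · rw [Finset.card_Ioo_finset (Finset.empty_subset S)]
    -- The open cube has 2^(f+1) - 2 members, where f = ⌊n/2⌋; this is at least 2^f + 1 since f ≥ 2.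
    have : 2 ^ 2 ≤ 2 ^ (n / 2) := Nat.pow_le_pow_right (by norm_num) (by omega)
    simp only [hS, Finset.card_empty, Nat.sub_zero, pow_succ]
    omega
  · obtain ⟨f, rfl⟩ := hn
    rw [Finset.card_insert_of_notMem, Finset.card_Icc_finset (Finset.subset_univ S)]
    · simp only [Finset.card_univ, Fintype.card_fin, hS]
      rw [show 2 * f + 1 - ((2 * f + 1) / 2 + 1) = (2 * f + 1) / 2 by omega]
    · rw [Finset.mem_Icc]
      rintro ⟨h, -⟩
      have := Finset.card_le_card h
      simp [hS] at this

/-! ### Lubell mass of subcubes -/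

/-- The Lubell mass of a subcube. -/
theorem lubellMass_Icc {n : ℕ} (A B : BoolLattice n) (h : A ⊆ B) {c : ℕ} (hc : B.card + c = n) :
    lubellMass (Finset.Icc A B) =
      (n + 1) * (A.card.factorial * c.factorial / (A.card + c + 1).factorial) := by
  induction hd : B.card - A.card generalizing A B c with
  | zero =>
    obtain rfl : A = B := Finset.eq_of_subset_of_card_le h (by omega)
    rw [Finset.Icc_self, lubellMass, Finset.sum_singleton,
      Nat.cast_choose ℝ (show A.card ≤ n by omega), Nat.factorial_succ, hc,
      show n - A.card = c by omega]
    push_cast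
    have := Nat.factorial_ne_zero n
    field_simp
  | succ d ih =>
    obtain ⟨x, hxB, hxA⟩ := Finset.exists_mem_notMem_of_card_lt_card (s := A) (t := B) (by omega)
    -- Splitting by whether x is a member mirrors the Beta recursion B(a+1, c+2) + B(a+2, c+1) =
    -- B(a+1, c+1), the fraction in the formula being B(a+1, c+1).
    have hsplit : Finset.Icc A B = Finset.Icc A (B.erase x) ∪ Finset.Icc (insert x A) B := by
      ext X
      simp only [Finset.mem_union, Finset.mem_Icc, Finset.insert_subset_iff,
        Finset.subset_erase]
      tauto
    have hdisj : Disjoint (Finset.Icc A (B.erase x)) (Finset.Icc (insert x A) B) := by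
      refine Finset.disjoint_left.2 fun X h1 h2 => ?_
      simp only [Finset.mem_Icc, Finset.insert_subset_iff,
        Finset.subset_erase] at h1 h2
      exact h1.2.2 h2.1.1
    have hBx := Finset.card_erase_of_mem hxB
    have hAx := Finset.card_insert_of_notMem hxA
    rw [hsplit, lubellMass_union hdisj, ih A (B.erase x) (by
        rw [Finset.subset_erase]; exact ⟨h, hxA⟩) (c := c + 1) (by omega) (by omega),
      ih (insert x A) B (Finset.insert_subset hxB h) hc (by omega), hAx,
      show A.card + (c + 1) + 1 = A.card + c + 1 + 1 by ring,
      show A.card + 1 + c + 1 = A.card + c + 1 + 1 by ring, Nat.factorial_succ (A.card + c + 1),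
      Nat.factorial_succ c, Nat.factorial_succ A.card]
    push_cast
    have := Nat.factorial_ne_zero (A.card + c + 1)
    field_simp
    ring

theorem lubellMass_Icc_empty {n : ℕ} (A : BoolLattice n) {c : ℕ} (hc : A.card + c = n) :
    lubellMass (Finset.Icc ∅ A) = (n + 1) / (c + 1) := by
  rw [lubellMass_Icc ∅ A (Finset.empty_subset A) hc, Finset.card_empty, Nat.zero_add,
    Nat.factorial_succ]
  have := Nat.factorial_ne_zero c
  push_cast
  field_simp
  simp

theorem lubellMass_Icc_univ {n : ℕ} (B : BoolLattice n) :
    lubellMass (Finset.Icc B Finset.univ) = (n + 1) / (B.card + 1) := by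
  rw [lubellMass_Icc B Finset.univ (Finset.subset_univ B) (c := 0) (by simp), Nat.add_zero,
    Nat.factorial_succ]
  have := Nat.factorial_ne_zero B.card
  push_cast
  field_simp
  simp

theorem factorial_mul_factorial_le {a c : ℕ} (ha : 1 ≤ a) (hc : 1 ≤ c) :
    a.factorial * c.factorial ≤ (a + c - 1).factorial := by
  induction c, hc using Nat.le_induction with
  | base => simp
  | succ c hc ih =>
    rw [show a + (c + 1) - 1 = (a + c - 1) + 1 by omega, Nat.factorial_succ, Nat.factorial_succ]
    calc a.factorial * ((c + 1) * c.factorial) = (c + 1) * (a.factorial * c.factorial) := by ring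
      _ ≤ _ := Nat.mul_le_mul (by omega) ih

theorem lubellMass_Icc_le {n : ℕ} (A B : BoolLattice n) (h : A ⊆ B) {c : ℕ} (hc : B.card + c = n)
    (hA : 1 ≤ A.card) (hc1 : 1 ≤ c) :
    lubellMass (Finset.Icc A B) ≤ (n + 1) / ((A.card + c) * (A.card + c + 1)) := by
  rw [lubellMass_Icc A B h hc, mul_div_assoc', mul_comm, ← mul_div_assoc']
  have hf : ((A.card.factorial * c.factorial : ℕ) : ℝ) ≤ ((A.card + c - 1).factorial : ℕ) :=
    Nat.cast_le.2 (factorial_mul_factorial_le hA hc1)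
  obtain ⟨k, hk⟩ : ∃ k, A.card + c = k + 1 := ⟨A.card + c - 1, by omega⟩
  have hk' : (A.card : ℝ) + c = k + 1 := by exact_mod_cast hk
  rw [hk, Nat.add_sub_cancel] at hf
  rw [hk', hk, Nat.factorial_succ, Nat.factorial_succ]
  push_cast at hf ⊢
  have h0 : (0 : ℝ) < k.factorial := by exact_mod_cast Nat.factorial_pos k
  rw [mul_div_assoc', div_le_div_iff₀ (by positivity) (by positivity)]
  have hm := mul_le_mul_of_nonneg_right hf
    (by positivity : (0 : ℝ) ≤ (n + 1) * ((k + 1) * (k + 1 + 1)))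
  nlinarith

/-! ### Upper bound for the smaller Lubell mass -/

/-- Optimization for a single cut. Put N = n + 2 and x = n - c + 1 ≥ N/2. Either (n+1)/x ≤ √2 and
`h1` suffices, or x ≤ N/√2. In the latter case x(N - x) is at least its value (√2 - 1)N²/2 at x =
N/√2, and `h2` suffices. -/
theorem le_sqrt_two_add_one {n c m : ℝ} (hc : 0 ≤ c) (hcn : 2 * c ≤ n)
    (h1 : m ≤ 1 + (n + 1) / (n - c + 1))
    (h2 : 2 * m ≤ (n + 1) / (c + 1) + (n + 1) / (n - c + 1)) : m ≤ √2 + 1 := by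
  have hs : √2 * √2 = 2 := Real.mul_self_sqrt (by norm_num)
  have hs0 : 0 < √2 := by positivity
  have hx0 : 0 < n - c + 1 := by linarith
  have hy0 : 0 < c + 1 := by linarith
  by_cases h : (n + 1) / (n - c + 1) ≤ √2
  · linarith
  rw [not_le, lt_div_iff₀ hx0] at h
  have hq : n - c + 1 ≤ √2 / 2 * (n + 2) := by nlinarith
  have hs1 : 1 ≤ √2 := by rw [Real.one_le_sqrt]; norm_num
  -- With x₀ = N/√2 this product equals x(N - x) - x₀(N - x₀).
  have hprod : 0 ≤ (√2 / 2 * (n + 2) - (n - c + 1)) * ((n - c + 1) + √2 / 2 * (n + 2) - (n + 2)) :=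
    mul_nonneg (by linarith) (by nlinarith)
  have hxy : (√2 / 2 - 1 / 2) * (n + 2) ^ 2 ≤ (n - c + 1) * (c + 1) := by nlinarith
  have hfin : (n + 1) * (n + 2) ≤ 2 * (√2 + 1) * ((n - c + 1) * (c + 1)) := by
    have := mul_le_mul_of_nonneg_left hxy (show 0 ≤ 2 * (√2 + 1) by positivity)
    nlinarith
  have hsum : (n + 1) / (c + 1) + (n + 1) / (n - c + 1) =
      (n + 1) * (n + 2) / ((n - c + 1) * (c + 1)) := by
    field_simp
    ring
  have : (n + 1) * (n + 2) / ((n - c + 1) * (c + 1)) ≤ 2 * (√2 + 1) := by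
    rwa [div_le_iff₀ (mul_pos hx0 hy0)]
  linarith

theorem IsCut.lubellMass_add_le {n : ℕ} {F G : Finset (BoolLattice n)} {S : BoolLattice n}
    (h : IsCut (F ∪ G) S) (hd : Disjoint F G) :
    lubellMass F + lubellMass G ≤
      lubellMass (Finset.Icc ∅ S) + lubellMass (Finset.Icc S Finset.univ) := by
  rw [← lubellMass_union hd]
  refine (lubellMass_mono fun X hX => ?_).trans (lubellMass_union_le _ _)
  simpa using h X hX

theorem IsGap.min_lubellMass_le {n : ℕ} {F G : Finset (BoolLattice n)} {A B : BoolLattice n}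
    (h : IsGap F G A B) : min (lubellMass F) (lubellMass G) ≤
      lubellMass (Finset.Icc ∅ A) + lubellMass (Finset.Icc B Finset.univ) := by
  refine le_trans ?_ (lubellMass_union_le _ _)
  rcases h.subset_outer with hs | hs
  · exact (min_le_left _ _).trans (lubellMass_mono hs)
  · exact (min_le_right _ _).trans (lubellMass_mono hs)

theorem IsGap.lubellMass_add_le {n : ℕ} {F G : Finset (BoolLattice n)} {A B : BoolLattice n}
    (h : IsGap F G A B) (hd : Disjoint F G) :
    lubellMass F + lubellMass G ≤ lubellMass (Finset.Icc ∅ A) +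
      lubellMass (Finset.Icc B Finset.univ) + lubellMass (Finset.Icc A B) := by
  rw [← lubellMass_union hd]
  refine (lubellMass_mono (h.union_subset.trans
    (Finset.union_subset_union_right Finset.Ioo_subset_Icc_self))).trans
    ((lubellMass_union_le _ _).trans ?_)
  exact add_le_add_left (lubellMass_union_le _ _) _

theorem min_lubellMass_le {n : ℕ} (hn : 100 ≤ n) {F G : Finset (BoolLattice n)}
    (h : CrossComparable F G) (hd : Disjoint F G) :
    min (lubellMass F) (lubellMass G) ≤ √2 + 1 := by
  obtain ⟨A, B, hg, hA, hB⟩ := exists_isGap h hd (t := n / 2) (by omega)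
  have hBn : B.card ≤ n := by simpa using Finset.card_le_univ B
  obtain ⟨c, hc⟩ : ∃ c, B.card + c = n := ⟨n - B.card, by omega⟩
  obtain ⟨b, hb⟩ : ∃ b, A.card + b = n := ⟨n - A.card, by omega⟩
  have h1 := hg.min_lubellMass_le
  have h2 := hg.lubellMass_add_le hd
  have h3 : 2 * min (lubellMass F) (lubellMass G) ≤ lubellMass F + lubellMass G := by
    linarith [min_le_left (lubellMass F) (lubellMass G), min_le_right (lubellMass F) (lubellMass G)]
  have hcR : (c : ℝ) = n - B.card := by
    have : (B.card : ℝ) + c = n := by exact_mod_cast hc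
    linarith
  have hbR : (b : ℝ) = n - A.card := by
    have : (A.card : ℝ) + b = n := by exact_mod_cast hb
    linarith
  have hnR : (100 : ℝ) ≤ n := by exact_mod_cast hn
  have ha2 : 2 * (A.card : ℝ) ≤ n := by exact_mod_cast (by omega : 2 * A.card ≤ n)
  have hc2 : 2 * (c : ℝ) ≤ n := by exact_mod_cast (by omega : 2 * c ≤ n)
  have eA := lubellMass_Icc_empty A hb
  have eB := lubellMass_Icc_univ B
  have hBR : (B.card : ℝ) = n - c := by rw [hcR]; ring
  rw [hBR] at eB
  rw [hbR] at eA
  rcases Nat.eq_zero_or_pos A.card with hA0 | hA0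
  -- With A = ∅ only the cut B matters: its two cubes cover both families. The case B = [n] is dual.
  · refine le_sqrt_two_add_one (n := n) (c := c) (by positivity) hc2 ?_ ?_
    · rw [eA, eB, hA0] at h1
      rwa [Nat.cast_zero, sub_zero, div_self (by linarith)] at h1
    · have h4 := hg.cut_right.lubellMass_add_le hd
      rw [lubellMass_Icc_empty B hc, eB] at h4
      linarith
  rcases Nat.eq_zero_or_pos c with hc0 | hc0
  · refine le_sqrt_two_add_one (n := n) (c := A.card) (Nat.cast_nonneg _) ha2 ?_ ?_
    · rw [eA, eB, hc0] at h1
      rw [Nat.cast_zero, sub_zero, div_self (by linarith)] at h1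
      linarith
    · have h4 := hg.cut_left.lubellMass_add_le hd
      rw [eA, lubellMass_Icc_univ A] at h4
      linarith
  have hs : (1.4 : ℝ) ≤ √2 := Real.le_sqrt_of_sq_le (by norm_num)
  have ha0' : (0 : ℝ) ≤ A.card := Nat.cast_nonneg _
  have hc0' : (0 : ℝ) ≤ c := Nat.cast_nonneg _
  have hmid := lubellMass_Icc_le A B hg.subset hc hA0 hc0
  -- With A and B both proper there is slack, as 2.4 ≤ √2 + 1. For small |A| + c the outer cubes
  -- weigh at most 1.2 each; otherwise they weigh at most 2 each and the middle at most 0.8, so half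
  -- the total is at most 2.4.
  rcases le_or_gt (6 * ((A.card : ℝ) + c)) n with hk | hk
  · have l1 : (n + 1 : ℝ) / (n - A.card + 1) ≤ 1.2 := by
      rw [div_le_iff₀ (by linarith)]
      linarith
    have l2 : (n + 1 : ℝ) / (n - c + 1) ≤ 1.2 := by
      rw [div_le_iff₀ (by linarith)]
      linarith
    linarith
  · have l1 : (n + 1 : ℝ) / (n - A.card + 1) ≤ 2 := by
      rw [div_le_iff₀ (by linarith)]
      linarith
    have l2 : (n + 1 : ℝ) / (n - c + 1) ≤ 2 := by
      rw [div_le_iff₀ (by linarith)]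
      linarith
    have l3 : (n + 1 : ℝ) / ((A.card + c) * (A.card + c + 1)) ≤ 0.8 := by
      have hk0 : (0 : ℝ) < A.card + c := by linarith
      rw [div_le_iff₀ (mul_pos hk0 (by linarith))]
      nlinarith
    linarith

/-! ### Lower bound for G' and its limit -/

theorem lubellMass_singleton_le {n : ℕ} (S : BoolLattice n) (h0 : 1 ≤ S.card) (hn : S.card < n) :
    lubellMass {S} ≤ 1 / n := by
  obtain ⟨c, hc⟩ : ∃ c, S.card + c = n := ⟨n - S.card, by omega⟩
  have := lubellMass_Icc_le S S subset_rfl hc h0 (by omega)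
  rw [Finset.Icc_self, show (S.card : ℝ) + c = n by exact_mod_cast hc] at this
  refine this.trans_eq ?_
  have : (n : ℝ) ≠ 0 := by norm_cast; omega
  field_simp

theorem lubellMass_singleton_empty {n : ℕ} : lubellMass {(∅ : BoolLattice n)} = 1 := by
  simp [lubellMass]

theorem le_GPrime_of_card {n s : ℕ} (h0 : 1 ≤ s) (hn : s < n) :
    min ((n + 1 : ℝ) / (n - s + 1) - 1 - 1 / n) (1 + (n + 1 : ℝ) / (s + 1)) ≤ GPrime n 2 := by
  obtain ⟨S, rfl⟩ := exists_card_eq hn.le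
  refine le_GPrime_two (crossComparable_Ioo_insert S) (disjoint_Ioo_insert S)
    ((min_le_left _ _).trans ?_) ((min_le_right _ _).trans ?_)
  · have hsub : Finset.Icc ∅ S ⊆ (Finset.Ioo ∅ S ∪ {∅}) ∪ {S} := by
      intro X hX
      simp only [Finset.mem_Icc, Finset.mem_union, Finset.mem_Ioo, Finset.mem_singleton] at hX ⊢
      rcases eq_or_lt_of_le hX.2 with h | h
      · exact Or.inr h
      rcases eq_or_lt_of_le hX.1 with h' | h'
      · exact Or.inl (Or.inr h'.symm)
      · exact Or.inl (Or.inl ⟨h', h⟩)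
    have h1 := (lubellMass_mono hsub).trans (lubellMass_union_le _ _)
    have h2 := lubellMass_union_le (Finset.Ioo ∅ S) {∅}
    have h3 := lubellMass_singleton_le S h0 hn
    rw [lubellMass_singleton_empty] at h2
    rw [lubellMass_Icc_empty S (c := n - S.card) (by omega), Nat.cast_sub hn.le] at h1
    linarith
  · rw [Finset.insert_eq, lubellMass_union, lubellMass_singleton_empty, lubellMass_Icc_univ]
    rw [Finset.disjoint_singleton_left, Finset.mem_Icc]
    rintro ⟨h, -⟩
    have := Finset.card_le_card h
    simp only [Finset.card_empty] at this
    omega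

theorem tendsto_GPrime_two : Tendsto (fun n : ℕ => GPrime n 2) atTop (𝓝 (√2 + 1)) := by
  have hs : √2 * √2 = 2 := Real.mul_self_sqrt (by norm_num)
  have hs0 : 0 < √2 := by positivity
  have hs1 : 1 < √2 := by rw [Real.lt_sqrt] <;> norm_num
  have hs2 : √2 < 2 := by rw [Real.sqrt_lt'] <;> norm_num
  -- The density σ = √2/2 balances the two masses: 1/(1 - σ) - 1 = 1 + 1/σ = √2 + 1.
  let s : ℕ → ℕ := fun n => ⌊√2 / 2 * (n : ℝ)⌋₊
  have hlim : Tendsto (fun n : ℕ => (s n : ℝ) / n) atTop (𝓝 (√2 / 2)) :=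
    (tendsto_nat_floor_mul_div_atTop (by positivity)).comp tendsto_natCast_atTop_atTop
  have hinv : Tendsto (fun n : ℕ => 1 / (n : ℝ)) atTop (𝓝 0) := tendsto_one_div_atTop_nhds_zero_nat
  have hL1 : Tendsto (fun n : ℕ => (1 + 1 / (n : ℝ)) / (1 - (s n : ℝ) / n + 1 / n) - 1 - 1 / n)
      atTop (𝓝 ((1 + 0) / (1 - √2 / 2 + 0) - 1 - 0)) :=
    ((((hinv.const_add 1).div ((hlim.const_sub 1).add hinv) (by linarith)).sub_const 1).sub hinv)
  have hL2 : Tendsto (fun n : ℕ => 1 + (1 + 1 / (n : ℝ)) / ((s n : ℝ) / n + 1 / n))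
      atTop (𝓝 (1 + (1 + 0) / (√2 / 2 + 0))) :=
    ((hinv.const_add 1).div (hlim.add hinv) (by positivity)).const_add 1
  have hL := hL1.min hL2
  have e1 : (1 + 0) / (1 - √2 / 2 + 0) - 1 - 0 = √2 + 1 := by
    have : 2 - √2 ≠ 0 := by linarith
    have : 1 - √2 / 2 ≠ 0 := by linarith
    rw [add_zero, add_zero, sub_zero, sub_eq_iff_eq_add, div_eq_iff this]
    nlinarith
  have e2 : 1 + (1 + 0) / (√2 / 2 + 0) = √2 + 1 := by
    rw [add_zero, add_zero, add_comm, add_left_inj, div_eq_iff (by positivity)]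
    nlinarith
  rw [e1, e2, min_self] at hL
  refine tendsto_of_tendsto_of_tendsto_of_le_of_le' hL tendsto_const_nhds ?_ ?_
  · filter_upwards [eventually_ge_atTop 100] with n hn
    have hnR : (100 : ℝ) ≤ n := by exact_mod_cast hn
    have hn0 : (n : ℝ) ≠ 0 := by positivity
    have h1 : 1 ≤ s n := by
      refine Nat.le_floor ?_
      push_cast
      nlinarith
    have h2 : s n < n := by
      refine (Nat.floor_lt (by positivity)).2 ?_
      nlinarith
    refine le_trans (le_of_eq ?_) (le_GPrime_of_card h1 h2)
    congr 1
    · rw [show 1 - (s n : ℝ) / n + 1 / n = (n - s n + 1) / n by field_simp,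
        show 1 + 1 / (n : ℝ) = (n + 1) / n by field_simp, div_div_div_cancel_right₀ hn0]
    · rw [show (s n : ℝ) / n + 1 / n = (s n + 1) / n by field_simp,
        show 1 + 1 / (n : ℝ) = (n + 1) / n by field_simp, div_div_div_cancel_right₀ hn0]
  · filter_upwards [eventually_ge_atTop 100] with n hn
    exact GPrime_two_le fun F G h hd => min_lubellMass_le hn h hd

end RainbowBoolean

theorem corollary4p5 :
    -- (i)
    ((∀ n : ℕ, 5 ≤ n → Odd n → RainbowBoolean.FPrime n 2 = 2 ^ (n / 2) + 2) ∧
      (∀ n : ℕ, Even n → n ≠ 2 → RainbowBoolean.FPrime n 2 = 2 ^ (n / 2))) ∧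
    -- (ii): here `n / 2` is the floor and `(n + 1) / 2` the ceiling of half of `n`
    (∀ (n : ℕ) (𝓕 : Fin 2 → Finset (RainbowBoolean.BoolLattice n)),
      RainbowBoolean.MutuallyComparable 𝓕 →
      ∀ (m : ℕ) (S : Fin (m + 1) → RainbowBoolean.BoolLattice n),
        RainbowBoolean.IsCoreChain 𝓕 S →
        (∀ j, (S j).card ≠ n / 2 ∧ (S j).card ≠ (n + 1) / 2) →
        ((min (𝓕 0).card (𝓕 1).card : ℕ) : ℝ) ≤ (2 : ℝ) ^ (((n / 2 : ℕ) : ℤ) - 1) + 4) ∧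
    -- (iii)
    Tendsto (fun n : ℕ => RainbowBoolean.GPrime n 2) atTop (𝓝 (√2 + 1)) :=
  ⟨⟨fun _ h5 hn => RainbowBoolean.FPrime_two_of_odd h5 hn,
      fun _ hn hn2 => RainbowBoolean.FPrime_two_of_even hn hn2⟩,
    fun _ _ _ _ _ hc hS => hc.min_card_le hS, RainbowBoolean.tendsto_GPrime_two⟩
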